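/- **Setting.** For a measurable space $\mathcal X$ let $\mathcal P(\mathcal X)$ be the set of probability measures on $\mathcal X$, and $\mathcal S(\mathcal X)$ the Banach space of finite signed measures with the total variation norm; $i:\mathcal P(\mathcal X)\hookrightarrow\mathcal S(\mathcal X)$ is the inclusion. Let $k\in\{1,2,3,\dots\}\cup\{\infty\}$. A *$C^k$-diffeology* on a nonempty set $X$ is a set $\mathcal D$ of maps $\mathbf p:U\to X$, where $U$ is an open subset of $\mathbb R^n$ and $n\ge 0$ is arbitrary, such that (D1) $\mathcal D$ contains all constant maps $\mathbb R^n\to X$; (D2) if $\mathbf p:U\to X$ and every $r\in U$ has an open neighbourhood $V\subset U$ with $\mathbf p|_V\in\mathcal D$, then $\mathbf p\in\mathcal D$; (D3) if $\mathbf p:U\to X$ is in $\mathcal D$, $V\subset\mathbb R^m$ is open and $\psi:V\to U$ is of class $C^k$, then $\mathbf p\circ\psi\in\mathcal D$. A *$C^k$-diffeological statistical model* on $\mathcal X$ is a pair $(P_{\mathcal X},\mathcal D_{\mathcal X})$, where $P_{\mathcal X}\subset\mathcal P(\mathcal X)$ is nonempty and $\mathcal D_{\mathcal X}$ is a $C^k$-diffeology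 on $P_{\mathcal X}$ such that $i\circ\mathbf p:U\to\mathcal S(\mathcal X)$ is of class $C^k$ for every $\mathbf p:U\to P_{\mathcal X}$ in $\mathcal D_{\mathcal X}$. For $\xi\in P_{\mathcal X}$ the *tangent cone* $C_\xi(P_{\mathcal X},\mathcal D_{\mathcal X})\subset\mathcal S(\mathcal X)$ is the set of all $\frac{d}{dt}\big|_{t=0}(i\circ c)$, where $c:\mathbb R\to P_{\mathcal X}$ is in $\mathcal D_{\mathcal X}$ and $c(0)=\xi$. Every such tangent vector $v$ is absolutely continuous with respect to $\xi$; put $\log v:=dv/d\xi\in L^1(\mathcal X,\xi)$. The model is *almost 2-integrable* if $\log v\in L^2(\mathcal X,\xi)$ for all $\xi\in P_{\mathcal X}$ and all $v\in C_\xi(P_{\mathcal X},\mathcal D_{\mathcal X})$. It is *2-integrable* if, moreover, for every $\mathbf p:U\to P_{\mathcal X}$ in $\mathcal D_{\mathcal X}$ the function $$TU=U\times\mathbb R^n\to\mathbb R,\qquad (x,v)\mapsto |d\mathbf p_x(v)|_{\mathfrak g}=\Big(\int_{\mathcal X}\Big(\frac{d\,(d\mathbf p_x(v))}{d\,\mathbf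 p(x)}\Big)^2 d\mathbf p(x)\Big)^{1/2}$$ is continuous, where $d\mathbf p_x(v)\in\mathcal S(\mathcal X)$ is the derivative of $i\circ\mathbf p$ at $x$ in the direction $v$. A *probabilistic mapping* $T:\mathcal X\leadsto\mathcal Y$ between measurable spaces is a Markov kernel. It induces $T_*:\mathcal P(\mathcal X)\to\mathcal P(\mathcal Y)$, $T_*\mu(B)=\int_{\mathcal X}T(x)(B)\,d\mu(x)$. For a $C^k$-diffeological statistical model $(P_{\mathcal X},\mathcal D_{\mathcal X})$ let $T_*(P_{\mathcal X})$ be the image of $P_{\mathcal X}$, and let $T_*(\mathcal D_{\mathcal X})$ be the set of all maps $\mathbf p:U\to T_*(P_{\mathcal X})$, $U$ open in some $\mathbb R^n$, such that every $r\in U$ has an open neighbourhood $V\subset U$ for which either $\mathbf p|_V$ is constant or $\mathbf p|_V=T_*\circ\mathbf q$ for some $\mathbf q:V\to P_{\mathcal X}$ in $\mathcal D_{\mathcal X}$. **Theorem.** Let $T:\mathcal X\leadsto\mathcal Y$ be a probabilistic mapping and $(P_{\mathcal X},\mathcal D_{\mathcal X})$ a $C^k$-diffeological statistical model. 1. $(T_*(P_{\mathcal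 X}),T_*(\mathcal D_{\mathcal X}))$ is a $C^k$-diffeological statistical model. 2. If $(P_{\mathcal X},\mathcal D_{\mathcal X})$ is almost 2-integrable, then so is $(T_*(P_{\mathcal X}),T_*(\mathcal D_{\mathcal X}))$. 3. If $(P_{\mathcal X},\mathcal D_{\mathcal X})$ is 2-integrable, then so is $(T_*(P_{\mathcal X}),T_*(\mathcal D_{\mathcal X}))$. -/

import Mathlib

open MeasureTheory ProbabilityTheory TopologicalSpace

noncomputable section

namespace DiffStat

/-! ### The normed space of finite signed measures -/

section SignedMeasures

variable {α : Type*} [MeasurableSpace α]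

/-- The total variation norm `‖μ‖ = |μ|(α)` of a finite signed measure. -/
def tvNorm (μ : SignedMeasure α) : ℝ := μ.totalVariation.real Set.univ

theorem tvNorm_add_le (μ ν : SignedMeasure α) : tvNorm (μ + ν) ≤ tvNorm μ + tvNorm ν := by
  have h : (μ + ν).totalVariation ≤ μ.totalVariation + ν.totalVariation := by
    simp only [SignedMeasure.totalVariation_eq_variation]
    exact VectorMeasure.variation_add_le
  have h1 := ENNReal.toReal_mono (measure_ne_top _ _) (h Set.univ)
  rw [Measure.add_apply, ENNReal.toReal_add (measure_ne_top _ _) (measure_ne_top _ _)] at h1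
  exact h1

theorem tvNorm_smul (c : ℝ) (μ : SignedMeasure α) : tvNorm (c • μ) = ‖c‖ * tvNorm μ := by
  have h : (c • μ).totalVariation = ‖c‖₊ • μ.totalVariation := by
    simp only [SignedMeasure.totalVariation_eq_variation]
    exact VectorMeasure.variation_smul
  simp [tvNorm, h, measureReal_def]

theorem abs_apply_le_tvNorm (μ : SignedMeasure α) (A : Set α) : |μ A| ≤ tvNorm μ :=
  (μ.norm_le_totalVariation A).trans (measureReal_mono (Set.subset_univ A))

theorem eq_zero_of_tvNorm (μ : SignedMeasure α) (h : tvNorm μ = 0) : μ = 0 := by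
  ext A _
  have h1 := abs_apply_le_tvNorm μ A
  rw [h] at h1
  simpa using h1

/-- The space of finite signed measures is normed by the total variation norm. -/
instance instNormedAddCommGroup : NormedAddCommGroup (SignedMeasure α) :=
  AddGroupNorm.toNormedAddCommGroup
    { toFun := tvNorm
      map_zero' := by rw [tvNorm, SignedMeasure.totalVariation_zero]; simp
      add_le' := tvNorm_add_le
      neg' := fun μ => by rw [tvNorm, SignedMeasure.totalVariation_neg, tvNorm]
      eq_zero_of_map_eq_zero' := eq_zero_of_tvNorm }

theorem norm_eq_tvNorm (μ : SignedMeasure α) : ‖μ‖ = tvNorm μ := rfl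

instance instNormedSpace : NormedSpace ℝ (SignedMeasure α) where
  norm_smul_le c μ := (tvNorm_smul c μ).le

/-- The inclusion of the probability measures into the space of finite signed measures. -/
def incl (μ : ProbabilityMeasure α) : SignedMeasure α := (μ : Measure α).toSignedMeasure

end SignedMeasures

/-! ### Diffeologies -/

/-- The real `n`-space, whose open subsets are the domains of parametrizations. -/
abbrev RSpace (n : ℕ) : Type := EuclideanSpace ℝ (Fin n)

/-- Extension by zero of a map given on an open set only. -/
def zeroExtend {n : ℕ} {F : Type*} [Zero F] {U : Opens (RSpace n)} (f : U → F) : RSpace n → F :=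
  Function.extend Subtype.val f 0

/-- `f : U → F` is of class `C^k` on the open set `U ⊆ ℝⁿ`. Since `U` is open, the values of the
extension off `U` are irrelevant. -/
def IsCk (k : ℕ∞) {n : ℕ} {F : Type*} [NormedAddCommGroup F] [NormedSpace ℝ F]
    {U : Opens (RSpace n)} (f : U → F) : Prop :=
  ContDiffOn ℝ k (zeroExtend f) U

/-- A set of parametrizations `p : U → X`, with `U` open in `ℝⁿ` and `n` running over `ℕ`. -/
abbrev ParamSet (X : Type*) := ∀ (n : ℕ) (U : Opens (RSpace n)), Set (U → X)

/-- `D` is a `C^k`-diffeology on the nonempty set `X`. -/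
structure IsDiffeology (k : ℕ∞) {X : Type*} (D : ParamSet X) : Prop where
  nonempty : Nonempty X
  covering : ∀ (n : ℕ) (x : X), (fun _ => x) ∈ D n ⊤
  locality : ∀ (n : ℕ) (U : Opens (RSpace n)) (p : U → X),
    (∀ r : U, ∃ (V : Opens (RSpace n)) (hVU : V ≤ U),
      (r : RSpace n) ∈ V ∧ (fun x : V => p (Set.inclusion hVU x)) ∈ D n V) →
    p ∈ D n U
  compat : ∀ (n m : ℕ) (U : Opens (RSpace n)) (V : Opens (RSpace m)) (p : U → X) (ψ : V → U),
    p ∈ D n U → IsCk k (fun y : V => (ψ y : RSpace n)) → p ∘ ψ ∈ D m V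

/-- The image of a diffeology under a map `f : X → Y`: the maps into `Y` which locally either are
constant or lift along `f` to an element of `D`. -/
def ParamSet.image {X Y : Type*} (f : X → Y) (D : ParamSet X) : ParamSet Y := fun n U =>
  {p | ∀ r : U, ∃ (V : Opens (RSpace n)) (hVU : V ≤ U), (r : RSpace n) ∈ V ∧
    ((∃ y : Y, ∀ x : V, p (Set.inclusion hVU x) = y) ∨
      ∃ q ∈ D n V, ∀ x : V, p (Set.inclusion hVU x) = f (q x))}

/-! ### Diffeological statistical models -/

section Models

variable {𝒳 : Type*} [MeasurableSpace 𝒳]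

/-- `(P, D)` is a `C^k`-diffeological statistical model: `D` is a `C^k`-diffeology on the (nonempty)
set `P` of probability measures, and every element of `D` is of class `C^k` as a map into the space
of finite signed measures with the total variation norm. -/
structure IsDiffeologicalModel (k : ℕ∞) (P : Set (ProbabilityMeasure 𝒳)) (D : ParamSet P) :
    Prop where
  isDiffeology : IsDiffeology k D
  isCk : ∀ (n : ℕ) (U : Opens (RSpace n)), ∀ p ∈ D n U, IsCk k (fun x : U => incl (p x).1)

/-- The curve `c : ℝ → P` belongs to `D`, with `ℝ` viewed as one-dimensional Euclidean space. -/
def IsCurve {P : Set (ProbabilityMeasure 𝒳)} (D : ParamSet P) (c : ℝ → P) : Prop :=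
  (fun x : (⊤ : Opens (RSpace 1)) => c (x.1 0)) ∈ D 1 ⊤

/-- The tangent cone of `(P, D)` at `ξ`: the velocities at time `0` of the curves in `D` through
`ξ`. -/
def tangentCone {P : Set (ProbabilityMeasure 𝒳)} (D : ParamSet P) (ξ : P) :
    Set (SignedMeasure 𝒳) :=
  {v | ∃ c : ℝ → P, IsCurve D c ∧ c 0 = ξ ∧ HasDerivAt (fun t => incl (c t).1) v 0}

/-- The logarithmic representation `log v = dv/dξ` of a tangent vector at `ξ`. It is an honest
density, see `absolutelyContinuous_of_mem_tangentCone`. -/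
def logRep (ξ : ProbabilityMeasure 𝒳) (v : SignedMeasure 𝒳) : 𝒳 → ℝ := v.rnDeriv (ξ : Measure 𝒳)

/-- Tangent vectors at `ξ` are dominated by `ξ`. -/
theorem absolutelyContinuous_of_mem_tangentCone {P : Set (ProbabilityMeasure 𝒳)} {D : ParamSet P}
    {ξ : P} {v : SignedMeasure 𝒳} (hv : v ∈ tangentCone D ξ) :
    v ≪ᵥ ((ξ.1 : Measure 𝒳)).toENNRealVectorMeasure := by
  obtain ⟨c, -, rfl, hd⟩ := hv
  refine VectorMeasure.AbsolutelyContinuous.mk fun A hA h0 => ?_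
  rw [Measure.toENNRealVectorMeasure_apply_measurable hA] at h0
  let L : SignedMeasure 𝒳 →L[ℝ] ℝ := LinearMap.mkContinuous
    { toFun := fun μ => μ A, map_add' := fun _ _ => rfl, map_smul' := fun _ _ => rfl } 1
    (fun μ => by rw [one_mul]; exact abs_apply_le_tvNorm μ A)
  have hL : HasDerivAt (fun t => incl (c t).1 A) (v A) 0 := L.hasFDerivAt.comp_hasDerivAt 0 hd
  have hval : ∀ t, incl (c t).1 A = ((c t).1 : Measure 𝒳).real A := fun t =>
    Measure.toSignedMeasure_apply_measurable hA
  refine IsLocalMin.hasDerivAt_eq_zero (Filter.Eventually.of_forall fun t => ?_) hL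
  simp only [hval]
  simp [measureReal_def, h0]

/-- `⟨log v, log w⟩` in `L²(ξ)`, the Fisher metric at `ξ`. -/
def fisherMetric (ξ : ProbabilityMeasure 𝒳) (v w : SignedMeasure 𝒳) : ℝ :=
  ∫ x, logRep ξ v x * logRep ξ w x ∂(ξ : Measure 𝒳)

/-- The length of a tangent vector in the Fisher metric. -/
def fisherNorm (ξ : ProbabilityMeasure 𝒳) (v : SignedMeasure 𝒳) : ℝ := √(fisherMetric ξ v v)

/-- Almost 2-integrable `C^k`-diffeological statistical models: the logarithmic representations of
all tangent cones consist of square integrable functions. -/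
structure IsAlmostTwoIntegrable (k : ℕ∞) (P : Set (ProbabilityMeasure 𝒳)) (D : ParamSet P) :
    Prop where
  isModel : IsDiffeologicalModel k P D
  memLp : ∀ ξ : P, ∀ v ∈ tangentCone D ξ, MemLp (logRep ξ.1 v) 2 (ξ.1 : Measure 𝒳)

/-- The differential `dp(v)` of `p : U → P` (into the space of signed measures) at the point `x ∈ U`
in the direction `v`. -/
def plotDifferential {P : Set (ProbabilityMeasure 𝒳)} {n : ℕ} {U : Opens (RSpace n)} (p : U → P)
    (x : U) (v : RSpace n) : SignedMeasure 𝒳 :=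
  fderiv ℝ (zeroExtend fun y : U => incl (p y).1) x v

/-- 2-integrable `C^k`-diffeological statistical models: almost 2-integrable, and for all `p : U → P`
in `D` the Fisher length of `dp(v)` is continuous on the tangent bundle `TU = U × ℝⁿ`. -/
structure IsTwoIntegrable (k : ℕ∞) (P : Set (ProbabilityMeasure 𝒳)) (D : ParamSet P) :
    Prop where
  almost : IsAlmostTwoIntegrable k P D
  continuous_norm : ∀ (n : ℕ) (U : Opens (RSpace n)), ∀ p ∈ D n U,
    Continuous fun z : U × RSpace n => fisherNorm (p z.1).1 (plotDifferential p z.1 z.2)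

end Models

/-! ### Pushforward along a probabilistic mapping -/

section Pushforward

variable {𝒳 𝒴 : Type*} [MeasurableSpace 𝒳] [MeasurableSpace 𝒴]

/-- The Markov morphism `T_*` on probability measures, `T_* μ (B) = ∫ T(x)(B) dμ(x)`. -/
def markovMap (T : Kernel 𝒳 𝒴) [IsMarkovKernel T] (μ : ProbabilityMeasure 𝒳) :
    ProbabilityMeasure 𝒴 :=
  ⟨(μ : Measure 𝒳).bind T, inferInstance⟩

theorem markovMap_apply (T : Kernel 𝒳 𝒴) [IsMarkovKernel T] (μ : ProbabilityMeasure 𝒳) {B : Set 𝒴}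
    (hB : MeasurableSet B) :
    (markovMap T μ : Measure 𝒴) B = ∫⁻ x, T x B ∂(μ : Measure 𝒳) :=
  Measure.bind_apply hB T.aemeasurable

/-- The set `T_*(P)` of probability measures on `𝒴`. -/
def pushModel (T : Kernel 𝒳 𝒴) [IsMarkovKernel T] (P : Set (ProbabilityMeasure 𝒳)) :
    Set (ProbabilityMeasure 𝒴) :=
  markovMap T '' P

/-- The set `T_*(D)` of maps into `T_*(P)`: the image of `D` under `T_* : P → T_*(P)`. -/
def pushDiffeology (T : Kernel 𝒳 𝒴) [IsMarkovKernel T] {P : Set (ProbabilityMeasure 𝒳)}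
    (D : ParamSet P) : ParamSet (pushModel T P) :=
  D.image (Set.imageFactorization (markovMap T) P)

end Pushforward

end DiffStat

end

noncomputable section

namespace DiffStat

open scoped NNReal ENNReal

/-! ### Bounded operators between spaces of signed measures -/

section Operators

variable {α β : Type*} [MeasurableSpace α] [MeasurableSpace β]

/-! The map `T_*` extends to a bounded linear operator `bindCLM T` on signed measures. Composing
with it preserves the class `C^k`, and by the chain rule the differential of a plot of the image
model is locally zero or the image of a differential upstairs.

Square integrability survives because `bindCLM T` sends `f ξ` to `g (T_* ξ)`, where `g` is the
conditional expectation of `f(x)` given `y` under the joint law `ξ ⊗ₘ T`. Conditional expectation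
contracts every `L^p` norm with `p ≥ 1` (`exists_density_bindCLM`).

Contraction alone does not give continuity of the Fisher norm. For this, let `ξ i → ξ₀` and `v i →
v₀` in total variation with convergent Fisher norms (`tendsto_fisherNorm_bindCLM`). Approximate the
density of `v₀` in `L²(ξ₀)` by a bounded function `φ`. Expanding the square shows that the density
of `v i` is eventually as close to the same `φ` in `L²(ξ i)`, and contraction carries both errors
through `T`. What remains are the images of `φ ξ i`. Their densities share one bound, and for
uniformly bounded densities total variation convergence already gives convergence of the Fisher
norms (`tendsto_fisherNorm_of_bounded`). -/

theorem norm_toSignedMeasure (μ : Measure α) [IsFiniteMeasure μ] :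
    ‖μ.toSignedMeasure‖ = μ.real Set.univ := by
  rw [norm_eq_tvNorm, tvNorm, SignedMeasure.totalVariation_eq_variation,
    Measure.variation_toSignedMeasure]

theorem norm_withDensityᵥ {μ : Measure α} {f : α → ℝ} (hf : Integrable f μ) :
    ‖μ.withDensityᵥ f‖ = ∫ x, ‖f x‖ ∂μ := by
  rw [norm_eq_tvNorm, tvNorm, SignedMeasure.totalVariation_eq_variation,
    Measure.variation_withDensityᵥ hf, measureReal_def, withDensity_apply _ MeasurableSet.univ,
    Measure.restrict_univ, integral_norm_eq_lintegral_enorm hf.1]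

theorem norm_eq_posPart_add_negPart (v : SignedMeasure α) :
    ‖v‖ = v.toJordanDecomposition.posPart.real Set.univ +
      v.toJordanDecomposition.negPart.real Set.univ := by
  rw [norm_eq_tvNorm, tvNorm, SignedMeasure.totalVariation, measureReal_add_apply]

/-- Evaluation at a measurable set is a bounded functional. -/
def evalCLM (A : Set α) : SignedMeasure α →L[ℝ] ℝ :=
  LinearMap.mkContinuous
    { toFun := fun μ => μ A, map_add' := fun _ _ => rfl, map_smul' := fun _ _ => rfl } 1
    (fun μ => by rw [one_mul]; exact abs_apply_le_tvNorm μ A)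

@[simp] theorem evalCLM_apply (A : Set α) (v : SignedMeasure α) : evalCLM A v = v A := rfl

theorem toSignedMeasure_sub_eq_iff {μ ν μ' ν' : Measure α} [IsFiniteMeasure μ]
    [IsFiniteMeasure ν] [IsFiniteMeasure μ'] [IsFiniteMeasure ν'] :
    μ.toSignedMeasure - ν.toSignedMeasure = μ'.toSignedMeasure - ν'.toSignedMeasure ↔
      μ + ν' = μ' + ν := by
  rw [sub_eq_sub_iff_add_eq_add, ← Measure.toSignedMeasure_add, ← Measure.toSignedMeasure_add,
    Measure.toSignedMeasure_eq_toSignedMeasure_iff]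

variable (K : Kernel α β) [IsFiniteKernel K]

/-- The action of a finite kernel on signed measures. -/
def bindSigned (v : SignedMeasure α) : SignedMeasure β :=
  (v.toJordanDecomposition.posPart.bind K).toSignedMeasure -
    (v.toJordanDecomposition.negPart.bind K).toSignedMeasure

/-- Any decomposition into finite measures may replace the Jordan decomposition: two differences
agree iff the crosswise sums agree, and `bind` is additive on measures. Linearity of `bindSigned`
rests on this. -/
theorem bindSigned_sub (μ ν : Measure α) [IsFiniteMeasure μ] [IsFiniteMeasure ν] :
    bindSigned K (μ.toSignedMeasure - ν.toSignedMeasure) =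
      (μ.bind K).toSignedMeasure - (ν.bind K).toSignedMeasure := by
  set v := μ.toSignedMeasure - ν.toSignedMeasure with hv
  have h : v.toJordanDecomposition.posPart + ν = μ + v.toJordanDecomposition.negPart :=
    toSignedMeasure_sub_eq_iff.1 (v.toSignedMeasure_toJordanDecomposition.trans hv)
  rw [bindSigned, toSignedMeasure_sub_eq_iff, ← Measure.comp_add, ← Measure.comp_add, h]

theorem bindSigned_toSignedMeasure (μ : Measure α) [IsFiniteMeasure μ] :
    bindSigned K μ.toSignedMeasure = (μ.bind K).toSignedMeasure := by
  have h := bindSigned_sub K μ 0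
  rw [Measure.toSignedMeasure_zero, sub_zero] at h
  rw [h, sub_eq_self, ← Measure.toSignedMeasure_zero,
    Measure.toSignedMeasure_eq_toSignedMeasure_iff, Measure.bind_zero_left]

theorem exists_eq_sub (v : SignedMeasure α) : ∃ (μ ν : Measure α) (_ : IsFiniteMeasure μ)
    (_ : IsFiniteMeasure ν), v = μ.toSignedMeasure - ν.toSignedMeasure :=
  ⟨_, _, inferInstance, inferInstance,
    (SignedMeasure.toSignedMeasure_toJordanDecomposition v).symm⟩

theorem bindSigned_add (v w : SignedMeasure α) :
    bindSigned K (v + w) = bindSigned K v + bindSigned K w := by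
  obtain ⟨μ, ν, _, _, rfl⟩ := exists_eq_sub v
  obtain ⟨μ', ν', _, _, rfl⟩ := exists_eq_sub w
  rw [sub_add_sub_comm, ← Measure.toSignedMeasure_add, ← Measure.toSignedMeasure_add,
    bindSigned_sub, bindSigned_sub, bindSigned_sub, sub_add_sub_comm,
    ← Measure.toSignedMeasure_add, ← Measure.toSignedMeasure_add]
  simp only [Measure.comp_add]

theorem bindSigned_neg (v : SignedMeasure α) : bindSigned K (-v) = -bindSigned K v := by
  obtain ⟨μ, ν, _, _, rfl⟩ := exists_eq_sub v
  rw [neg_sub, bindSigned_sub, bindSigned_sub, neg_sub]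

theorem bindSigned_nnreal_smul (c : ℝ≥0) (v : SignedMeasure α) :
    bindSigned K (c • v) = c • bindSigned K v := by
  obtain ⟨μ, ν, _, _, rfl⟩ := exists_eq_sub v
  rw [smul_sub, ← Measure.toSignedMeasure_smul, ← Measure.toSignedMeasure_smul,
    bindSigned_sub, bindSigned_sub, smul_sub, ← Measure.toSignedMeasure_smul,
    ← Measure.toSignedMeasure_smul]
  have h (ρ : Measure α) : (c • ρ).bind K = c • ρ.bind K := Measure.comp_smul (c : ℝ≥0∞)
  simp only [h]

theorem bindSigned_smul (c : ℝ) (v : SignedMeasure α) :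
    bindSigned K (c • v) = c • bindSigned K v := by
  rcases le_total 0 c with hc | hc
  · lift c to ℝ≥0 using hc
    exact bindSigned_nnreal_smul K c v
  · obtain ⟨d, rfl⟩ : ∃ d, c = -d := ⟨-c, by simp⟩
    lift d to ℝ≥0 using by linarith
    rw [neg_smul, neg_smul, bindSigned_neg]
    exact congrArg _ (bindSigned_nnreal_smul K d v)

theorem real_bind_univ_le (μ : Measure α) [IsFiniteMeasure μ] :
    (μ.bind K).real Set.univ ≤ K.bound.toReal * μ.real Set.univ := by
  rw [measureReal_def, measureReal_def, ← ENNReal.toReal_mul]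
  refine ENNReal.toReal_mono (ENNReal.mul_ne_top K.bound_ne_top (measure_ne_top _ _)) ?_
  rw [Measure.bind_apply MeasurableSet.univ K.aemeasurable]
  calc ∫⁻ x, K x Set.univ ∂μ ≤ ∫⁻ _, K.bound ∂μ :=
        lintegral_mono fun x => Kernel.measure_le_bound K x _
    _ = _ := by rw [lintegral_const]

theorem norm_bindSigned_le (v : SignedMeasure α) :
    ‖bindSigned K v‖ ≤ K.bound.toReal * ‖v‖ := by
  refine (norm_sub_le _ _).trans ?_
  rw [norm_toSignedMeasure, norm_toSignedMeasure, norm_eq_posPart_add_negPart, mul_add]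
  exact add_le_add (real_bind_univ_le K _) (real_bind_univ_le K _)

/-- The action of a finite kernel on signed measures, as a bounded operator. -/
def bindCLM : SignedMeasure α →L[ℝ] SignedMeasure β :=
  LinearMap.mkContinuous
    { toFun := bindSigned K, map_add' := bindSigned_add K, map_smul' := bindSigned_smul K }
    K.bound.toReal (norm_bindSigned_le K)

theorem bindCLM_toSignedMeasure (μ : Measure α) [IsFiniteMeasure μ] :
    bindCLM K μ.toSignedMeasure = (μ.bind K).toSignedMeasure :=
  bindSigned_toSignedMeasure K μ

theorem integrable_mul_kernel_real {μ : Measure α} {f : α → ℝ} (hf : Integrable f μ) {B : Set β}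
    (hB : MeasurableSet B) : Integrable (fun x => f x * (K x).real B) μ := by
  refine hf.mul_bdd (c := K.bound.toReal) (K.measurable_coe hB).ennreal_toReal.aestronglyMeasurable
    (Filter.Eventually.of_forall fun x => ?_)
  rw [Real.norm_of_nonneg measureReal_nonneg]
  exact ENNReal.toReal_mono K.bound_ne_top (Kernel.measure_le_bound K x _)

theorem bind_withDensity_real {μ : Measure α} {f : α → ℝ≥0∞} (hf : AEMeasurable f μ)
    (hfin : ∫⁻ x, f x ∂μ ≠ ∞) {B : Set β} (hB : MeasurableSet B) :
    ((μ.withDensity f).bind K).real B = ∫ x, (f x).toReal * (K x).real B ∂μ := by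
  have hm : Measurable fun x => K x B := K.measurable_coe hB
  rw [measureReal_def, Measure.bind_apply hB K.aemeasurable,
    lintegral_withDensity_eq_lintegral_mul₀ hf hm.aemeasurable, ← integral_toReal]
  · simp [measureReal_def]
  · exact hf.mul hm.aemeasurable
  · filter_upwards [ae_lt_top' hf hfin] with x hx
    exact ENNReal.mul_lt_top hx (measure_lt_top _ _)

/-- Splitting `f` into positive and negative parts reduces this to measures. The formula serves to
recognise `bindCLM` both as a multiplication operator and as a conditional expectation. -/
theorem bindCLM_withDensityᵥ_apply {μ : Measure α} {f : α → ℝ} (hf : Integrable f μ)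
    {B : Set β} (hB : MeasurableSet B) :
    bindCLM K (μ.withDensityᵥ f) B = ∫ x, f x * (K x).real B ∂μ := by
  have h1 := isFiniteMeasure_withDensity_ofReal hf.2
  have h2 := isFiniteMeasure_withDensity_ofReal hf.neg.2
  have h3 : ∫⁻ x, ENNReal.ofReal (f x) ∂μ ≠ ∞ := by
    simpa using (measure_lt_top (μ.withDensity fun x => ENNReal.ofReal (f x)) Set.univ).ne
  have h4 : ∫⁻ x, ENNReal.ofReal (-f x) ∂μ ≠ ∞ := by
    simpa using (measure_lt_top (μ.withDensity fun x => ENNReal.ofReal (-f x)) Set.univ).ne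
  rw [withDensityᵥ_eq_withDensity_pos_part_sub_withDensity_neg_part hf]
  refine (congrArg (fun w : SignedMeasure β => w B) (bindSigned_sub K _ _)).trans ?_
  rw [Measure.toSignedMeasure_sub_apply hB]
  have e1 := bind_withDensity_real K hf.1.aemeasurable.ennreal_ofReal h3 hB
  have e2 := bind_withDensity_real K hf.1.aemeasurable.neg.ennreal_ofReal h4 hB
  refine (congrArg₂ _ e1 e2).trans ?_
  have p1 := integrable_mul_kernel_real K hf.pos_part hB
  have p2 := integrable_mul_kernel_real K hf.neg_part hB
  simp only [ENNReal.toReal_ofReal', Pi.neg_apply]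
  rw [← integral_sub p1 p2]
  congr with x
  rw [← sub_mul]
  congr 1
  rcases le_total 0 (f x) with h | h <;> simp [h]

end Operators

/-! ### Multiplication of signed measures by bounded functions. -/

section Multiplication

variable {α : Type*} [MeasurableSpace α]

/-- The kernel `x ↦ φ(x)⁺ δ_x`. -/
def mulKernel (φ : α → ℝ) : Kernel α α :=
  Kernel.withDensity Kernel.id fun _ b => ENNReal.ofReal (φ b)

theorem isFiniteKernel_mulKernel {φ : α → ℝ} {M : ℝ} (hM : ∀ x, |φ x| ≤ M) :
    IsFiniteKernel (mulKernel φ) :=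
  Kernel.isFiniteKernel_withDensity_of_bounded _ (B := ENNReal.ofReal M) ENNReal.ofReal_ne_top
    fun _ b => ENNReal.ofReal_le_ofReal ((le_abs_self _).trans (hM b))

theorem mulKernel_real {φ : α → ℝ} (hφ : Measurable φ) (x : α) {B : Set α}
    (hB : MeasurableSet B) : (mulKernel φ x).real B = B.indicator (fun x => max (φ x) 0) x := by
  have hm : Measurable fun b => ENNReal.ofReal (φ b) := hφ.ennreal_ofReal
  rw [measureReal_def, mulKernel, Kernel.withDensity_apply' _ (f := fun _ b => ENNReal.ofReal (φ b))
      (hm.comp measurable_snd),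
    Kernel.id_apply, ← lintegral_indicator hB, lintegral_dirac' _ (hm.indicator hB)]
  by_cases hx : x ∈ B <;> simp [hx, ENNReal.toReal_ofReal']

/-- Multiplication by a bounded measurable function is a bounded operator on the space of signed
measures. -/
theorem exists_mulCLM {φ : α → ℝ} (hφ : Measurable φ) {M : ℝ} (hM : ∀ x, |φ x| ≤ M) :
    ∃ L : SignedMeasure α →L[ℝ] SignedMeasure α, ∀ (μ : Measure α) (f : α → ℝ),
      Integrable f μ → L (μ.withDensityᵥ f) = μ.withDensityᵥ fun x => φ x * f x := by
  have := isFiniteKernel_mulKernel hM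
  have := isFiniteKernel_mulKernel (φ := fun x => -φ x) (M := M) (by simpa using hM)
  -- Kernels carry only nonnegative weights, so multiplication by `φ` is the difference of the
  -- operators for `φ⁺` and `φ⁻`.
  refine ⟨bindCLM (mulKernel φ) - bindCLM (mulKernel fun x => -φ x), fun μ f hf => ?_⟩
  have hφf : Integrable (fun x => φ x * f x) μ :=
    hf.bdd_mul hφ.aestronglyMeasurable (Filter.Eventually.of_forall hM)
  ext B hB
  rw [withDensityᵥ_apply hφf hB, ← integral_indicator hB]
  change bindCLM (mulKernel φ) (μ.withDensityᵥ f) B -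
    bindCLM (mulKernel fun x => -φ x) (μ.withDensityᵥ f) B = _
  rw [bindCLM_withDensityᵥ_apply _ hf hB, bindCLM_withDensityᵥ_apply _ hf hB,
    ← integral_sub (integrable_mul_kernel_real _ hf hB) (integrable_mul_kernel_real _ hf hB)]
  congr with x
  rw [mulKernel_real hφ _ hB, mulKernel_real (φ := fun x => -φ x) hφ.neg _ hB]
  by_cases hx : x ∈ B
  · simp only [Set.indicator_of_mem hx]
    rcases le_total 0 (φ x) with h | h <;> simp [h, mul_comm]
  · simp [hx]

end Multiplication

/-! ### Densities and their images under a Markov kernel -/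

section Densities

variable {α β : Type*} [MeasurableSpace α] [MeasurableSpace β]

theorem lpNorm_two_sq {μ : Measure α} {f : α → ℝ} (hf : MemLp f 2 μ) :
    lpNorm f 2 μ ^ 2 = ∫ x, f x ^ 2 ∂μ := by
  have h0 : 0 ≤ ∫ x, f x ^ 2 ∂μ := integral_nonneg fun x => sq_nonneg _
  rw [lpNorm_eq_integral_norm_rpow_toReal two_ne_zero ENNReal.ofNat_ne_top hf.1]
  simp only [ENNReal.toReal_ofNat, Real.rpow_two, Real.norm_eq_abs, sq_abs]
  rw [← Real.rpow_two, ← Real.rpow_mul h0]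
  norm_num

theorem logRep_withDensityᵥ (ξ : ProbabilityMeasure α) {f : α → ℝ}
    (hf : Integrable f (ξ : Measure α)) :
    logRep ξ ((ξ : Measure α).withDensityᵥ f) =ᵐ[(ξ : Measure α)] f :=
  (SignedMeasure.eq_rnDeriv 0 f hf (VectorMeasure.MutuallySingular.zero_left)
    (zero_add _).symm).symm

theorem fisherNorm_withDensityᵥ (ξ : ProbabilityMeasure α) {f : α → ℝ}
    (hf : MemLp f 2 (ξ : Measure α)) :
    fisherNorm ξ ((ξ : Measure α).withDensityᵥ f) = lpNorm f 2 (ξ : Measure α) := by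
  have h := logRep_withDensityᵥ ξ (hf.integrable one_le_two)
  rw [fisherNorm, fisherMetric, ← Real.sqrt_sq (lpNorm_nonneg (f := f)), lpNorm_two_sq hf]
  congr 1
  refine integral_congr_ae ?_
  filter_upwards [h] with x hx
  rw [hx, sq]

@[simp] theorem fisherNorm_zero (ξ : ProbabilityMeasure α) : fisherNorm ξ 0 = 0 := by
  simpa using fisherNorm_withDensityᵥ ξ (MemLp.zero (μ := (ξ : Measure α)) (ε := ℝ))

theorem abs_fisherNorm_sub_le (ξ : ProbabilityMeasure α) {f g : α → ℝ}
    (hf : MemLp f 2 (ξ : Measure α)) (hg : MemLp g 2 (ξ : Measure α)) :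
    |fisherNorm ξ ((ξ : Measure α).withDensityᵥ f) - fisherNorm ξ ((ξ : Measure α).withDensityᵥ g)|
      ≤ lpNorm (f - g) 2 (ξ : Measure α) := by
  rw [fisherNorm_withDensityᵥ ξ hf, fisherNorm_withDensityᵥ ξ hg, abs_sub_le_iff]
  constructor
  · linarith [lpNorm_le_lpNorm_add_lpNorm_sub' (f := f) hg one_le_two]
  · linarith [lpNorm_le_lpNorm_add_lpNorm_sub (f := g) hf one_le_two]

/-- `v` has a square integrable density with respect to `ξ`. -/
def HasSqDensity (ξ : ProbabilityMeasure α) (v : SignedMeasure α) : Prop :=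
  ∃ f, MemLp f 2 (ξ : Measure α) ∧ v = (ξ : Measure α).withDensityᵥ f

theorem HasSqDensity.memLp_logRep {ξ : ProbabilityMeasure α} {v : SignedMeasure α}
    (h : HasSqDensity ξ v) : MemLp (logRep ξ v) 2 (ξ : Measure α) := by
  obtain ⟨f, hf, rfl⟩ := h
  exact hf.ae_eq (logRep_withDensityᵥ ξ (hf.integrable one_le_two)).symm

/-- Without absolute continuity `logRep` would lose the singular part of `v`. -/
theorem hasSqDensity_of_absolutelyContinuous {ξ : ProbabilityMeasure α} {v : SignedMeasure α}
    (hv : v ≪ᵥ (ξ : Measure α).toENNRealVectorMeasure)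
    (h : MemLp (logRep ξ v) 2 (ξ : Measure α)) : HasSqDensity ξ v :=
  ⟨logRep ξ v, h, (v.withDensityᵥ_rnDeriv_eq _ hv).symm⟩

theorem hasSqDensity_zero (ξ : ProbabilityMeasure α) : HasSqDensity ξ 0 :=
  ⟨0, MemLp.zero, withDensityᵥ_zero.symm⟩

variable (T : Kernel α β) [IsMarkovKernel T]

/-- A Markov kernel maps densities to densities and is contractive on all `Lᵖ`-spaces. -/
theorem exists_density_bindCLM (ξ : Measure α) [IsProbabilityMeasure ξ] {f : α → ℝ}
    (hf : Integrable f ξ) :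
    ∃ g : β → ℝ, Measurable g ∧ Integrable g (ξ.bind T) ∧
      bindCLM T (ξ.withDensityᵥ f) = (ξ.bind T).withDensityᵥ g ∧
      ∀ p, 1 ≤ p → eLpNorm g p (ξ.bind T) ≤ eLpNorm f p ξ := by
  have hsnd : MeasurePreserving Prod.snd (ξ ⊗ₘ T) (ξ.bind T) :=
    ⟨measurable_snd, Measure.snd_compProd ξ T⟩
  have hfst : MeasurePreserving Prod.fst (ξ ⊗ₘ T) ξ := ⟨measurable_fst, Measure.fst_compProd ξ T⟩
  have hf' : Integrable (f ∘ Prod.fst) (ξ ⊗ₘ T) := hfst.integrable_comp_of_integrable hf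
  have hm : MeasurableSpace.comap (Prod.snd : α × β → β) inferInstance ≤
    (inferInstance : MeasurableSpace (α × β)) := measurable_snd.comap_le
  -- The conditional expectation of `f(x)` given `y` is measurable for the σ-algebra generated by
  -- `y`, hence a function `g` of `y`.
  obtain ⟨g, hg, hgc⟩ := (stronglyMeasurable_condExp (f := f ∘ Prod.fst) (μ := ξ ⊗ₘ T)
    (m := MeasurableSpace.comap (Prod.snd : α × β → β) inferInstance)).exists_eq_measurable_comp
  have hnorm : ∀ p, 1 ≤ p → eLpNorm g p (ξ.bind T) ≤ eLpNorm f p ξ := fun p hp => by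
    rw [← eLpNorm_comp_measurePreserving hg.aestronglyMeasurable hsnd, ← hgc,
      ← eLpNorm_comp_measurePreserving hf.1 hfst]
    exact eLpNorm_condExp_le_eLpNorm _ hp
  have hgi : Integrable g (ξ.bind T) := by
    rw [← memLp_one_iff_integrable] at hf ⊢
    exact ⟨hg.aestronglyMeasurable, (hnorm 1 le_rfl).trans_lt hf.2⟩
  refine ⟨g, hg.measurable, hgi, ?_, hnorm⟩
  ext B hB
  rw [bindCLM_withDensityᵥ_apply T hf hB, withDensityᵥ_apply hgi hB]
  have e1 : ∫ y in B, g y ∂ξ.bind T = ∫ z in Prod.snd ⁻¹' B, g z.2 ∂(ξ ⊗ₘ T) := by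
    rw [← hsnd.map_eq]
    exact setIntegral_map hB hg.aestronglyMeasurable measurable_snd.aemeasurable
  have e2 := setIntegral_condExp hm hf' (s := Prod.snd ⁻¹' B) ⟨B, hB, rfl⟩
  rw [hgc] at e2
  rw [e1]
  refine Eq.trans ?_ e2.symm
  -- Fubini for `ξ ⊗ₘ T`: integrating `f(x)` over `y ∈ B` produces the factor `T x B`.
  rw [← Set.univ_prod, Measure.setIntegral_compProd MeasurableSet.univ hB hf'.integrableOn,
    Measure.restrict_univ]
  simp [mul_comm]

theorem coe_markovMap (ξ : ProbabilityMeasure α) :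
    (markovMap T ξ : Measure β) = (ξ : Measure α).bind T := rfl

theorem incl_markovMap (ξ : ProbabilityMeasure α) :
    incl (markovMap T ξ) = bindCLM T (incl ξ) :=
  (bindCLM_toSignedMeasure T (ξ : Measure α)).symm

theorem HasSqDensity.bindCLM {ξ : ProbabilityMeasure α} {v : SignedMeasure α}
    (h : HasSqDensity ξ v) : HasSqDensity (markovMap T ξ) (bindCLM T v) := by
  obtain ⟨f, hf, rfl⟩ := h
  obtain ⟨g, hg, -, hgf, hle⟩ := exists_density_bindCLM T (ξ : Measure α)
    (hf.integrable one_le_two)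
  exact ⟨g, ⟨hg.aestronglyMeasurable, (hle 2 one_le_two).trans_lt hf.2⟩, hgf⟩

/-- Approximation errors made upstairs do not grow under `T`: this is the `L²` contraction applied
to `f - g`. -/
theorem abs_fisherNorm_bindCLM_sub_le (ξ : ProbabilityMeasure α) {f g : α → ℝ}
    (hf : MemLp f 2 (ξ : Measure α)) (hg : MemLp g 2 (ξ : Measure α)) :
    |fisherNorm (markovMap T ξ) (bindCLM T ((ξ : Measure α).withDensityᵥ f)) -
      fisherNorm (markovMap T ξ) (bindCLM T ((ξ : Measure α).withDensityᵥ g))|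
      ≤ lpNorm (f - g) 2 (ξ : Measure α) := by
  have hfi := hf.integrable one_le_two
  have hgi := hg.integrable one_le_two
  obtain ⟨f', hf', hfi', hff', hfle⟩ := exists_density_bindCLM T (ξ : Measure α) hfi
  obtain ⟨g', hg', hgi', hgg', hgle⟩ := exists_density_bindCLM T (ξ : Measure α) hgi
  obtain ⟨h', hh', hhi', hhh', hhle⟩ := exists_density_bindCLM T (ξ : Measure α) (hfi.sub hgi)
  have hf2 : MemLp f' 2 (markovMap T ξ : Measure β) :=
    ⟨hf'.aestronglyMeasurable, (hfle 2 one_le_two).trans_lt hf.2⟩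
  have hg2 : MemLp g' 2 (markovMap T ξ : Measure β) :=
    ⟨hg'.aestronglyMeasurable, (hgle 2 one_le_two).trans_lt hg.2⟩
  rw [hff', hgg']
  refine (abs_fisherNorm_sub_le (markovMap T ξ) hf2 hg2).trans ?_
  -- The three densities were chosen independently; linearity of `bindCLM` and uniqueness of
  -- densities relate them.
  have hae : f' - g' =ᵐ[(ξ : Measure α).bind T] h' := by
    refine (hfi'.sub hgi').ae_eq_of_withDensityᵥ_eq hhi' ?_
    rw [withDensityᵥ_sub hfi' hgi', ← hhh', withDensityᵥ_sub hfi hgi, map_sub, hff', hgg']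
  rw [← toReal_eLpNorm (hf2.sub hg2).1, ← toReal_eLpNorm (hf.sub hg).1, coe_markovMap,
    eLpNorm_congr_ae hae]
  exact ENNReal.toReal_mono (hf.sub hg).2.ne (hhle 2 one_le_two)

end Densities

/-! ### Continuity of the Fisher norm under a Markov kernel -/

section Continuity

open Filter Topology

variable {α β ι : Type*} [MeasurableSpace α] [MeasurableSpace β] {l : Filter ι}

theorem incl_eq_withDensityᵥ (ξ : ProbabilityMeasure α) :
    incl ξ = (ξ : Measure α).withDensityᵥ fun _ => (1 : ℝ) := by
  ext B hB
  rw [incl, Measure.toSignedMeasure_apply_measurable hB,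
    withDensityᵥ_apply (integrable_const _) hB]
  simp

theorem memLp_of_abs_le {μ : Measure α} [IsFiniteMeasure μ] {φ : α → ℝ} (hφ : Measurable φ) {M : ℝ}
    (hM : ∀ x, |φ x| ≤ M) (p : ℝ≥0∞) : MemLp φ p μ :=
  MemLp.of_bound hφ.aestronglyMeasurable M (Eventually.of_forall hM)

/-- Multiplication by a bounded function, applied to probability measures. -/
theorem exists_mulCLM_incl {φ : α → ℝ} (hφ : Measurable φ) {M : ℝ} (hM : ∀ x, |φ x| ≤ M) :
    ∃ L : SignedMeasure α →L[ℝ] SignedMeasure α,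
      (∀ (μ : Measure α) (f : α → ℝ), Integrable f μ →
        L (μ.withDensityᵥ f) = μ.withDensityᵥ fun x => φ x * f x) ∧
      ∀ ξ : ProbabilityMeasure α, L (incl ξ) = (ξ : Measure α).withDensityᵥ φ := by
  obtain ⟨L, hL⟩ := exists_mulCLM hφ hM
  refine ⟨L, hL, fun ξ => ?_⟩
  rw [incl_eq_withDensityᵥ, hL _ _ (integrable_const _)]
  simp

/-- Integration of `φ` is a bounded functional: multiply by `φ`, then evaluate on the whole space.
-/
theorem tendsto_integral_of_bounded {ξ : ι → ProbabilityMeasure α} {ξ₀ : ProbabilityMeasure α}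
    (hξ : Tendsto (fun i => incl (ξ i)) l (𝓝 (incl ξ₀))) {φ : α → ℝ} (hφ : Measurable φ) {M : ℝ}
    (hM : ∀ x, |φ x| ≤ M) :
    Tendsto (fun i => ∫ x, φ x ∂(ξ i : Measure α)) l (𝓝 (∫ x, φ x ∂(ξ₀ : Measure α))) := by
  obtain ⟨L, -, hL⟩ := exists_mulCLM_incl hφ hM
  have h (ζ : ProbabilityMeasure α) :
      evalCLM Set.univ (L (incl ζ)) = ∫ x, φ x ∂(ζ : Measure α) := by
    rw [hL, evalCLM_apply, withDensityᵥ_apply ((memLp_of_abs_le hφ hM 1).integrable le_rfl)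
      MeasurableSet.univ, Measure.restrict_univ]
  simp only [← h]
  exact (((evalCLM Set.univ).comp L).continuous.tendsto _).comp hξ

theorem tendsto_fisherNorm_withDensityᵥ {ξ : ι → ProbabilityMeasure α} {ξ₀ : ProbabilityMeasure α}
    (hξ : Tendsto (fun i => incl (ξ i)) l (𝓝 (incl ξ₀))) {φ : α → ℝ} (hφ : Measurable φ) {M : ℝ}
    (hM : ∀ x, |φ x| ≤ M) :
    Tendsto (fun i => fisherNorm (ξ i) ((ξ i : Measure α).withDensityᵥ φ)) l
      (𝓝 (fisherNorm ξ₀ ((ξ₀ : Measure α).withDensityᵥ φ))) := by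
  have h (ζ : ProbabilityMeasure α) : fisherNorm ζ ((ζ : Measure α).withDensityᵥ φ) =
      √(∫ x, φ x ^ 2 ∂(ζ : Measure α)) := by
    rw [fisherNorm_withDensityᵥ ζ (memLp_of_abs_le hφ hM 2),
      ← lpNorm_two_sq (memLp_of_abs_le hφ hM 2), Real.sqrt_sq lpNorm_nonneg]
  simp only [h]
  refine (tendsto_integral_of_bounded hξ (hφ.pow_const 2) (M := M ^ 2) fun x => ?_).sqrt
  rw [abs_pow]
  exact pow_le_pow_left₀ (abs_nonneg _) (hM x) 2

/-- The Fisher norm is continuous along families of signed measures with uniformly bounded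
densities. -/
theorem tendsto_fisherNorm_of_bounded {ξ : ι → ProbabilityMeasure α} {ξ₀ : ProbabilityMeasure α}
    (hξ : Tendsto (fun i => incl (ξ i)) l (𝓝 (incl ξ₀))) {g : ι → α → ℝ} {g₀ : α → ℝ} {M : ℝ}
    (hg : ∀ i, Measurable (g i)) (hM : ∀ i, ∀ᵐ x ∂(ξ i : Measure α), |g i x| ≤ M)
    (hg₀ : Measurable g₀) (hM₀ : ∀ x, |g₀ x| ≤ M)
    (hv : Tendsto (fun i => (ξ i : Measure α).withDensityᵥ (g i)) l
      (𝓝 ((ξ₀ : Measure α).withDensityᵥ g₀))) :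
    Tendsto (fun i => fisherNorm (ξ i) ((ξ i : Measure α).withDensityᵥ (g i))) l
      (𝓝 (fisherNorm ξ₀ ((ξ₀ : Measure α).withDensityᵥ g₀))) := by
  obtain ⟨L, -, hL⟩ := exists_mulCLM_incl hg₀ hM₀
  have hmem (i) : MemLp (g i) 2 (ξ i : Measure α) :=
    MemLp.of_bound (hg i).aestronglyMeasurable M (hM i)
  have hmem₀ (i) : MemLp g₀ 2 (ξ i : Measure α) := memLp_of_abs_le hg₀ hM₀ 2
  -- The fixed function `g₀` is compared with `g i` under `ξ i`. Since `|g i - g₀| ≤ 2M`, the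
  -- squared `L²` distance is at most `2M` times the `L¹` distance, which is a total variation norm.
  have hdiff (i) : |fisherNorm (ξ i) ((ξ i : Measure α).withDensityᵥ (g i)) -
      fisherNorm (ξ i) ((ξ i : Measure α).withDensityᵥ g₀)| ≤
      √(2 * M * ‖(ξ i : Measure α).withDensityᵥ (g i) - L (incl (ξ i))‖) := by
    refine (abs_fisherNorm_sub_le (ξ i) (hmem i) (hmem₀ i)).trans (Real.le_sqrt_of_sq_le ?_)
    have hi := (hmem i).integrable one_le_two
    have hi₀ := (hmem₀ i).integrable one_le_two
    rw [lpNorm_two_sq ((hmem i).sub (hmem₀ i)), hL, ← withDensityᵥ_sub hi hi₀,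
      norm_withDensityᵥ (hi.sub hi₀), ← integral_const_mul]
    refine integral_mono_ae ((hmem i).sub (hmem₀ i)).integrable_sq
      ((hi.sub hi₀).norm.const_mul _) ?_
    filter_upwards [hM i] with x hx
    rw [Pi.sub_apply, ← sq_abs, sq, Real.norm_eq_abs]
    refine mul_le_mul_of_nonneg_right ?_ (abs_nonneg _)
    linarith [abs_sub (g i x) (g₀ x), hM₀ x]
  -- Both `g i ξ i` and `g₀ ξ i = L (incl (ξ i))` tend to `g₀ ξ₀`.
  have hlim : Tendsto (fun i =>
      √(2 * M * ‖(ξ i : Measure α).withDensityᵥ (g i) - L (incl (ξ i))‖)) l (𝓝 0) := by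
    have h1 := ((hv.sub ((L.continuous.tendsto _).comp hξ)).norm.const_mul (2 * M)).sqrt
    rwa [hL, sub_self, norm_zero, mul_zero, Real.sqrt_zero] at h1
  have h2 := tendsto_fisherNorm_withDensityᵥ hξ hg₀ hM₀
  have h3 := (squeeze_zero_norm hdiff hlim).add h2
  simpa using h3

/-! ### Passing limits through a Markov kernel. -/

variable (T : Kernel α β) [IsMarkovKernel T]

theorem tendsto_incl_markovMap {ξ : ι → ProbabilityMeasure α} {ξ₀ : ProbabilityMeasure α}
    (hξ : Tendsto (fun i => incl (ξ i)) l (𝓝 (incl ξ₀))) :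
    Tendsto (fun i => incl (markovMap T (ξ i))) l (𝓝 (incl (markovMap T ξ₀))) := by
  simp only [incl_markovMap]
  exact ((bindCLM T).continuous.tendsto _).comp hξ

theorem exists_bounded_density_bindCLM (ξ : ProbabilityMeasure α) {φ : α → ℝ} (hφ : Measurable φ)
    {M : ℝ} (hM : ∀ x, |φ x| ≤ M) :
    ∃ g : β → ℝ, Measurable g ∧ (∀ y, |g y| ≤ M) ∧
      bindCLM T ((ξ : Measure α).withDensityᵥ φ) = (markovMap T ξ : Measure β).withDensityᵥ g := by
  have hmem : MemLp φ ∞ (ξ : Measure α) := memLp_of_abs_le hφ hM ∞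
  obtain ⟨x₀, -⟩ : (Set.univ : Set α).Nonempty :=
    nonempty_of_measure_ne_zero (μ := (ξ : Measure α)) (by simp)
  have hM0 : 0 ≤ M := (abs_nonneg _).trans (hM x₀)
  obtain ⟨g, hg, hgi, hgeq, hle⟩ := exists_density_bindCLM T (ξ : Measure α)
    (hmem.integrable le_top)
  have hbd : ∀ᵐ y ∂(ξ : Measure α).bind T, |g y| ≤ M := by
    have h1 : eLpNorm g ∞ ((ξ : Measure α).bind T) ≤ ENNReal.ofReal M := by
      refine (hle ∞ le_top).trans ?_
      rw [eLpNorm_exponent_top]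
      exact eLpNormEssSup_le_of_ae_bound (Eventually.of_forall hM)
    rw [eLpNorm_exponent_top] at h1
    filter_upwards [ae_le_eLpNormEssSup (f := g) (μ := (ξ : Measure α).bind T)] with y hy
    have h2 := hy.trans h1
    rwa [← ofReal_norm, ENNReal.ofReal_le_ofReal_iff hM0] at h2
  -- The `L^∞` contraction bounds `g` only almost everywhere; truncation makes the bound hold
  -- everywhere.
  refine ⟨fun y => max (-M) (min (g y) M), measurable_const.max (hg.min measurable_const),
    fun y => abs_le.2 ⟨le_max_left _ _, max_le (by linarith) (min_le_right _ _)⟩, ?_⟩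
  rw [hgeq, coe_markovMap]
  refine WithDensityᵥEq.congr_ae ?_
  filter_upwards [hbd] with y hy
  rw [min_eq_left (abs_le.1 hy).2, max_eq_right (abs_le.1 hy).1]

/-- The image of `φ ξ i` has a density depending on `ξ i`, but the bound `M` is common to all of
them, so `tendsto_fisherNorm_of_bounded` applies. -/
theorem tendsto_fisherNorm_bindCLM_of_bounded {ξ : ι → ProbabilityMeasure α}
    {ξ₀ : ProbabilityMeasure α} (hξ : Tendsto (fun i => incl (ξ i)) l (𝓝 (incl ξ₀))) {φ : α → ℝ}
    (hφ : Measurable φ) {M : ℝ} (hM : ∀ x, |φ x| ≤ M) :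
    Tendsto (fun i => fisherNorm (markovMap T (ξ i))
        (bindCLM T ((ξ i : Measure α).withDensityᵥ φ))) l
      (𝓝 (fisherNorm (markovMap T ξ₀) (bindCLM T ((ξ₀ : Measure α).withDensityᵥ φ)))) := by
  obtain ⟨L, -, hL⟩ := exists_mulCLM_incl hφ hM
  choose g hg hgM hgeq using fun ζ : ProbabilityMeasure α =>
    exists_bounded_density_bindCLM T ζ hφ hM
  have h := (((bindCLM T).comp L).continuous.tendsto _).comp hξ
  simp only [Function.comp_def, ContinuousLinearMap.comp_apply, hL, hgeq] at h
  simp only [hgeq]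
  exact tendsto_fisherNorm_of_bounded (tendsto_incl_markovMap T hξ) (fun i => hg _)
    (fun i => Eventually.of_forall (hgM _)) (hg _) (hgM _) h

/-- In this form each term passes to the limit: the first by convergence of Fisher norms, the second
because it is a bounded functional of the signed measure `f μ`, the third because `φ` is bounded. -/
theorem lpNorm_sub_sq {μ : Measure α} {f φ : α → ℝ} (hf : MemLp f 2 μ) (hφ : MemLp φ 2 μ) :
    lpNorm (f - φ) 2 μ ^ 2 =
      lpNorm f 2 μ ^ 2 - 2 * ∫ x, φ x * f x ∂μ + ∫ x, φ x ^ 2 ∂μ := by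
  have hφf : Integrable (fun x => 2 * (φ x * f x)) μ := (hφ.integrable_mul hf).const_mul 2
  rw [lpNorm_two_sq hf, lpNorm_two_sq (hf.sub hφ), ← integral_const_mul,
    ← integral_sub hf.integrable_sq hφf,
    ← integral_add (f := fun x => f x ^ 2 - 2 * (φ x * f x)) (hf.integrable_sq.sub hφf)
      hφ.integrable_sq]
  congr with x
  simp only [Pi.sub_apply]
  ring

/-- If measures, tangent vectors and their Fisher norms converge, then so do the Fisher norms of
the images under a Markov kernel. -/
theorem tendsto_fisherNorm_bindCLM {ξ : ι → ProbabilityMeasure α} {ξ₀ : ProbabilityMeasure α}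
    {v : ι → SignedMeasure α} {v₀ : SignedMeasure α}
    (hξ : Tendsto (fun i => incl (ξ i)) l (𝓝 (incl ξ₀))) (hv : Tendsto v l (𝓝 v₀))
    (hsq : ∀ i, HasSqDensity (ξ i) (v i)) (hsq₀ : HasSqDensity ξ₀ v₀)
    (hN : Tendsto (fun i => fisherNorm (ξ i) (v i)) l (𝓝 (fisherNorm ξ₀ v₀))) :
    Tendsto (fun i => fisherNorm (markovMap T (ξ i)) (bindCLM T (v i))) l
      (𝓝 (fisherNorm (markovMap T ξ₀) (bindCLM T v₀))) := by
  choose f hf hfv using hsq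
  obtain ⟨f₀, hf₀, rfl⟩ := hsq₀
  obtain rfl : v = fun i => (ξ i : Measure α).withDensityᵥ (f i) := funext hfv
  clear hfv
  rw [Metric.tendsto_nhds]
  intro ε hε
  -- A simple function is defined and bounded everywhere, so it makes sense under every `ξ i`. One
  -- third of `ε` goes to the error at `ξ i`, one to that at `ξ₀`, one to the limit for `φ`.
  obtain ⟨φ, hφm, M, hM, hφε⟩ : ∃ φ : α → ℝ, Measurable φ ∧ ∃ M : ℝ, (∀ x, |φ x| ≤ M) ∧
      eLpNorm (f₀ - φ) 2 (ξ₀ : Measure α) < ENNReal.ofReal (ε / 3) := by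
    obtain ⟨φ, hφε, -⟩ := hf₀.exists_simpleFunc_eLpNorm_sub_lt ENNReal.ofNat_ne_top
      (ENNReal.ofReal_pos.2 (by positivity : 0 < ε / 3)).ne'
    exact ⟨φ, φ.measurable, φ.exists_forall_norm_le.imp fun M hM => ⟨hM, hφε⟩⟩
  have hφ (ζ : ProbabilityMeasure α) : MemLp φ 2 (ζ : Measure α) := memLp_of_abs_le hφm hM 2
  have hsmall : lpNorm (f₀ - φ) 2 (ξ₀ : Measure α) < ε / 3 := by
    rw [← toReal_eLpNorm (hf₀.sub (hφ _)).1]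
    exact (ENNReal.lt_ofReal_iff_toReal_lt (hf₀.sub (hφ _)).2.ne).1 hφε
  have hlim : Tendsto (fun i => lpNorm (f i - φ) 2 (ξ i : Measure α) ^ 2) l
      (𝓝 (lpNorm (f₀ - φ) 2 (ξ₀ : Measure α) ^ 2)) := by
    obtain ⟨L, hL, -⟩ := exists_mulCLM_incl hφm hM
    have hI {ζ : ProbabilityMeasure α} {h : α → ℝ} (hh : MemLp h 2 (ζ : Measure α)) :
        evalCLM Set.univ (L ((ζ : Measure α).withDensityᵥ h)) =
          ∫ x, φ x * h x ∂(ζ : Measure α) := by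
      have hφh : Integrable (fun x => φ x * h x) (ζ : Measure α) := (hφ ζ).integrable_mul hh
      rw [hL _ _ (hh.integrable one_le_two), evalCLM_apply,
        withDensityᵥ_apply hφh MeasurableSet.univ, Measure.restrict_univ]
    have h1 := (((evalCLM Set.univ).comp L).continuous.tendsto _).comp hv
    simp only [Function.comp_def, ContinuousLinearMap.comp_apply, hI hf₀, hI (hf _)] at h1
    have h2 := tendsto_integral_of_bounded hξ (hφm.pow_const 2) (M := M ^ 2) fun x => by
      rw [abs_pow]
      exact pow_le_pow_left₀ (abs_nonneg _) (hM x) 2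
    simp only [fisherNorm_withDensityᵥ _ (hf _), fisherNorm_withDensityᵥ _ hf₀] at hN
    simp only [lpNorm_sub_sq (hf _) (hφ _), lpNorm_sub_sq hf₀ (hφ _)]
    exact ((hN.pow 2).sub (h1.const_mul 2)).add h2
  have hev : ∀ᶠ i in l, lpNorm (f i - φ) 2 (ξ i : Measure α) < ε / 3 := by
    filter_upwards [hlim.eventually_lt_const (pow_lt_pow_left₀ hsmall lpNorm_nonneg two_ne_zero)]
      with i hi
    exact lt_of_pow_lt_pow_left₀ 2 (by positivity) hi
  filter_upwards [hev, (Metric.tendsto_nhds.1 (tendsto_fisherNorm_bindCLM_of_bounded T hξ hφm hM))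
    (ε / 3) (by positivity)] with i hi hi'
  have a1 := abs_fisherNorm_bindCLM_sub_le T (ξ i) (hf i) (hφ _)
  have a2 := abs_fisherNorm_bindCLM_sub_le T ξ₀ hf₀ (hφ _)
  rw [Real.dist_eq] at hi' ⊢
  rw [abs_lt] at hi' ⊢
  rw [abs_le] at a1 a2
  constructor <;> linarith

end Continuity

/-! ### Maps of class `C^k` on open sets and images of diffeologies -/

section Ck

open Filter Topology

variable {n : ℕ} {F : Type*} [NormedAddCommGroup F]

theorem zeroExtend_apply {U : Opens (RSpace n)} (f : U → F) (x : U) :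
    zeroExtend f x = f x :=
  Subtype.val_injective.extend_apply f 0 x

theorem zeroExtend_eventuallyEq {U V : Opens (RSpace n)} (hVU : V ≤ U) {f : U → F}
    {g : RSpace n → F} (h : ∀ x : V, f (Set.inclusion hVU x) = g x) (x : V) :
    zeroExtend f =ᶠ[𝓝 (x : RSpace n)] g := by
  filter_upwards [V.isOpen.mem_nhds x.2] with y hy
  exact (zeroExtend_apply f ⟨y, hVU hy⟩).trans (h ⟨y, hy⟩)

variable {k : ℕ∞} [NormedSpace ℝ F]

theorem isCk_iff_contDiffAt {U : Opens (RSpace n)} {f : U → F} :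
    IsCk k f ↔ ∀ x : U, ContDiffAt ℝ k (zeroExtend f) x := by
  constructor
  · exact fun h x => h.contDiffAt (U.isOpen.mem_nhds x.2)
  · exact fun h x hx => (h ⟨x, hx⟩).contDiffWithinAt

/-- Being `C^k` depends only on germs. This suits plots of an image diffeology, which lift only
locally. -/
theorem isCk_of_locally {U : Opens (RSpace n)} {f : U → F}
    (h : ∀ r : U, ∃ (V : Opens (RSpace n)) (hVU : V ≤ U), (r : RSpace n) ∈ V ∧
      ∃ g : RSpace n → F, ContDiffOn ℝ k g V ∧ ∀ x : V, f (Set.inclusion hVU x) = g x) :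
    IsCk k f := by
  rw [isCk_iff_contDiffAt]
  intro r
  obtain ⟨V, hVU, hr, g, hg, hfg⟩ := h r
  exact (hg.contDiffAt (V.isOpen.mem_nhds hr)).congr_of_eventuallyEq
    (zeroExtend_eventuallyEq hVU hfg ⟨r, hr⟩)

theorem isCk_of_contDiffOn {U : Opens (RSpace n)} {f : U → F} {g : RSpace n → F}
    (hg : ContDiffOn ℝ k g U) (h : ∀ x : U, f x = g x) : IsCk k f :=
  isCk_of_locally fun r => ⟨U, le_rfl, r.2, g, hg, h⟩

theorem IsCk.continuous {U : Opens (RSpace n)} {f : U → F} (hf : IsCk k f) : Continuous f := by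
  have h := continuousOn_iff_continuous_domRestrict.1 hf.continuousOn
  exact h.congr fun x => zeroExtend_apply f x

/-- Constants and locality are built into `ParamSet.image`. For `compat`, a local lift on `W` is
composed with `ψ` restricted to the preimage of `W`. -/
theorem IsDiffeology.image {X Y : Type*} {D : ParamSet X} (hD : IsDiffeology k D) (f : X → Y) :
    IsDiffeology k (D.image f) where
  nonempty := hD.nonempty.map f
  covering n y r := ⟨⊤, le_rfl, trivial, Or.inl ⟨y, fun _ => rfl⟩⟩
  locality n U p h r := by
    obtain ⟨V, hVU, hr, hp⟩ := h r
    obtain ⟨W, hWV, hrW, hW⟩ := hp ⟨r, hr⟩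
    exact ⟨W, hWV.trans hVU, hrW, hW⟩
  compat n m U V p ψ hp hψ r := by
    obtain ⟨W, hWU, hr, hW⟩ := hp (ψ r)
    have hcont : Continuous fun y : V => (ψ y : RSpace n) := hψ.continuous
    let W' : Opens (RSpace m) :=
      ⟨Subtype.val '' {y : V | (ψ y : RSpace n) ∈ W},
        V.isOpen.isOpenMap_subtype_val _ (W.isOpen.preimage hcont)⟩
    have hWV : W' ≤ V := by
      rintro _ ⟨y, -, rfl⟩
      exact y.2
    have hmem (x : W') : (ψ (Set.inclusion hWV x) : RSpace n) ∈ W := by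
      obtain ⟨_, y, hy, rfl⟩ := x
      exact hy
    refine ⟨W', hWV, ⟨r, hr, rfl⟩, ?_⟩
    rcases hW with ⟨y, hy⟩ | ⟨q, hq, hpq⟩
    · exact Or.inl ⟨y, fun x => hy ⟨_, hmem x⟩⟩
    · refine Or.inr ⟨q ∘ fun x => ⟨_, hmem x⟩, hD.compat _ _ _ _ q _ hq ?_,
        fun x => hpq ⟨_, hmem x⟩⟩
      exact isCk_of_contDiffOn (hψ.mono hWV) fun x =>
        (zeroExtend_apply (fun y : V => (ψ y : RSpace n)) (Set.inclusion hWV x)).symm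

end Ck

/-! ### Tangent vectors of models and of their images -/

section Tangent

open Filter Topology

variable {𝒳 𝒴 : Type*} [MeasurableSpace 𝒳] [MeasurableSpace 𝒴] {k : ℕ∞} {n : ℕ}
  {P : Set (ProbabilityMeasure 𝒳)} {D : ParamSet P}

theorem IsDiffeologicalModel.differentiableAt (h : IsDiffeologicalModel k P D) (hk : 1 ≤ k)
    {U : Opens (RSpace n)} {p : U → P} (hp : p ∈ D n U) (x : U) :
    DifferentiableAt ℝ (zeroExtend fun y : U => incl (p y).1) x :=
  (isCk_iff_contDiffAt.1 (h.isCk n U p hp) x).differentiableAt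
    (zero_lt_one.trans_le (by exact_mod_cast hk)).ne'

/-- Curves of the tangent cone live on all of `ℝ`, whereas the line `x + t w` may leave `U`. The
time change `δ sin(t/δ)` is smooth, has speed `1` at `0` and stays bounded by `δ`. -/
theorem plotDifferential_mem_tangentCone (h : IsDiffeologicalModel k P D) (hk : 1 ≤ k)
    {U : Opens (RSpace n)} {p : U → P} (hp : p ∈ D n U) (x : U) (w : RSpace n) :
    plotDifferential p x w ∈ tangentCone D (p x) := by
  obtain ⟨r, hr, hball⟩ := Metric.isOpen_iff.1 U.isOpen x x.2
  -- Chosen so that `δ ‖w‖ < r`; the `+ 1` covers `w = 0`.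
  set δ : ℝ := r / (‖w‖ + 1) with hδ
  have hw : 0 < ‖w‖ + 1 := by positivity
  have hδ0 : 0 < δ := by positivity
  set ψ : ℝ → RSpace n := fun t => x + (δ * Real.sin (t / δ)) • w with hψ
  have hψU (t : ℝ) : ψ t ∈ U := by
    apply hball
    rw [Metric.mem_ball, dist_eq_norm, hψ, add_sub_cancel_left, norm_smul, norm_mul,
      Real.norm_of_nonneg hδ0.le]
    calc δ * ‖Real.sin (t / δ)‖ * ‖w‖ ≤ δ * 1 * ‖w‖ := by
          gcongr
          exact Real.abs_sin_le_one _
      _ < δ * (‖w‖ + 1) := by nlinarith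
      _ = r := by rw [hδ]; field_simp
  have hψ0 : ψ 0 = x := by simp [hψ]
  have hψ' : HasDerivAt ψ w 0 := by
    have h1 : HasDerivAt (fun t : ℝ => δ * Real.sin (t / δ)) 1 0 := by
      have h2 := (((hasDerivAt_id (0 : ℝ)).div_const δ).sin).const_mul δ
      convert! h2 using 1
      simp [hδ0.ne']
    simpa [hψ] using (h1.smul_const w).const_add (x : RSpace n)
  refine ⟨fun t => p ⟨ψ t, hψU t⟩, ?_, ?_, ?_⟩
  · refine h.isDiffeology.compat n 1 U ⊤ p (fun y => ⟨ψ (y.1 0), hψU _⟩) hp ?_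
    refine isCk_of_contDiffOn (g := fun y : RSpace 1 => ψ (y 0)) ?_ fun _ => rfl
    have : ContDiff ℝ k fun y : RSpace 1 => ψ (y 0) := by
      simp only [hψ]
      fun_prop
    exact this.contDiffOn
  · exact congrArg p (Subtype.ext hψ0)
  · have hd := (h.differentiableAt hk hp x).hasFDerivAt
    rw [← hψ0] at hd
    have hcomp := hd.comp_hasDerivAt 0 hψ'
    rw [hψ0] at hcomp
    refine hcomp.congr_of_eventuallyEq (Eventually.of_forall fun t => ?_)
    exact (zeroExtend_apply (fun y : U => incl (p y).1) ⟨ψ t, hψU t⟩).symm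

/-- The curve itself is a one-dimensional plot. Working with plots allows restriction to a small
open set, where a lift exists; a curve on all of `ℝ` need not lift globally. -/
theorem exists_plotDifferential_eq (h : IsDiffeologicalModel k P D) (hk : 1 ≤ k) {ξ : P}
    {v : SignedMeasure 𝒳} (hv : v ∈ tangentCone D ξ) :
    ∃ p ∈ D 1 ⊤, ∃ x w, p x = ξ ∧ v = plotDifferential p x w := by
  obtain ⟨c, hc, rfl, hd⟩ := hv
  have hγ : HasDerivAt (fun t : ℝ => t • EuclideanSpace.single (0 : Fin 1) (1 : ℝ))
      (EuclideanSpace.single (0 : Fin 1) (1 : ℝ)) 0 := by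
    simpa using (hasDerivAt_id (0 : ℝ)).smul_const (EuclideanSpace.single (0 : Fin 1) (1 : ℝ))
  refine ⟨_, hc, ⟨0, trivial⟩, EuclideanSpace.single (0 : Fin 1) (1 : ℝ), rfl, ?_⟩
  have hp := (h.differentiableAt hk hc ⟨0, trivial⟩).hasFDerivAt
  refine hd.unique ?_
  have hz : (0 : RSpace 1) = (0 : ℝ) • EuclideanSpace.single (0 : Fin 1) (1 : ℝ) := by simp
  have hcomp := (hz ▸ hp).comp_hasDerivAt (0 : ℝ) hγ
  refine (hcomp.congr_of_eventuallyEq (Eventually.of_forall fun t => ?_)).congr_deriv ?_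
  · refine Eq.trans ?_ (zeroExtend_apply (fun y : (⊤ : Opens (RSpace 1)) => incl (c (y.1 0)).1)
      ⟨t • EuclideanSpace.single (0 : Fin 1) (1 : ℝ), trivial⟩).symm
    simp
  · simp [plotDifferential]

theorem IsAlmostTwoIntegrable.hasSqDensity (h : IsAlmostTwoIntegrable k P D) (hk : 1 ≤ k)
    {U : Opens (RSpace n)} {p : U → P} (hp : p ∈ D n U) (x : U) (w : RSpace n) :
    HasSqDensity (p x).1 (plotDifferential p x w) := by
  have hv := plotDifferential_mem_tangentCone h.isModel hk hp x w
  exact hasSqDensity_of_absolutelyContinuous (absolutelyContinuous_of_mem_tangentCone hv)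
    (h.memLp _ _ hv)

theorem IsDiffeologicalModel.continuous_incl (h : IsDiffeologicalModel k P D)
    {U : Opens (RSpace n)} {p : U → P} (hp : p ∈ D n U) : Continuous fun x => incl (p x).1 :=
  (h.isCk n U p hp).continuous

theorem IsDiffeologicalModel.continuous_plotDifferential (h : IsDiffeologicalModel k P D)
    (hk : 1 ≤ k) {U : Opens (RSpace n)} {p : U → P} (hp : p ∈ D n U) :
    Continuous fun z : U × RSpace n => plotDifferential p z.1 z.2 := by
  have h1 := continuousOn_iff_continuous_domRestrict.1
    ((h.isCk n U p hp).continuousOn_fderiv_of_isOpen U.isOpen (by exact_mod_cast hk))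
  exact (h1.comp continuous_fst).clm_apply continuous_snd

/-! ### Differentials of plots of the image model and the three transfer statements. -/

variable (T : Kernel 𝒳 𝒴) [IsMarkovKernel T]

theorem plotDifferential_of_const {U V : Opens (RSpace n)} (hVU : V ≤ U) {p : U → P} {ξ : P}
    (hp : ∀ x : V, p (Set.inclusion hVU x) = ξ) (x : V) (w : RSpace n) :
    plotDifferential p (Set.inclusion hVU x) w = 0 := by
  have h := zeroExtend_eventuallyEq hVU (f := fun y : U => incl (p y).1)
    (g := fun _ => incl ξ.1) (fun x => by rw [hp]) x
  rw [plotDifferential]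
  change fderiv ℝ _ (x : RSpace n) w = 0
  rw [h.fderiv_eq]
  simp

theorem incl_eq_bindCLM_zeroExtend {U V : Opens (RSpace n)} (hVU : V ≤ U)
    {p : U → pushModel T P} {q : V → P}
    (hpq : ∀ x : V, p (Set.inclusion hVU x) = Set.imageFactorization (markovMap T) P (q x))
    (x : V) : incl (p (Set.inclusion hVU x)).1 =
      bindCLM T (zeroExtend (fun y : V => incl (q y).1) x) := by
  rw [hpq, zeroExtend_apply]
  exact incl_markovMap T _

theorem plotDifferential_of_lift (h : IsDiffeologicalModel k P D) (hk : 1 ≤ k)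
    {U V : Opens (RSpace n)} (hVU : V ≤ U) {p : U → pushModel T P} {q : V → P} (hq : q ∈ D n V)
    (hpq : ∀ x : V, p (Set.inclusion hVU x) = Set.imageFactorization (markovMap T) P (q x))
    (x : V) (w : RSpace n) :
    plotDifferential p (Set.inclusion hVU x) w = bindCLM T (plotDifferential q x w) := by
  have he := zeroExtend_eventuallyEq hVU (f := fun y : U => incl (p y).1)
    (g := fun y => bindCLM T (zeroExtend (fun y : V => incl (q y).1) y))
    (incl_eq_bindCLM_zeroExtend T hVU hpq) x
  rw [plotDifferential]
  change fderiv ℝ _ (x : RSpace n) w = _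
  rw [he.fderiv_eq]
  exact congrArg (fun L => L w)
    ((bindCLM T).hasFDerivAt.comp (x : RSpace n) (h.differentiableAt hk hq x).hasFDerivAt).fderiv

theorem IsDiffeologicalModel.push (h : IsDiffeologicalModel k P D) :
    IsDiffeologicalModel k (pushModel T P) (pushDiffeology T D) where
  isDiffeology := h.isDiffeology.image _
  isCk n U p hp := isCk_of_locally fun r => by
    obtain ⟨V, hVU, hr, ⟨y, hy⟩ | ⟨q, hq, hpq⟩⟩ := hp r
    · exact ⟨V, hVU, hr, fun _ => incl y.1, contDiffOn_const, fun x => by rw [hy]⟩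
    · exact ⟨V, hVU, hr, _, (bindCLM T).contDiff.comp_contDiffOn (h.isCk n V q hq),
        incl_eq_bindCLM_zeroExtend T hVU hpq⟩

theorem IsAlmostTwoIntegrable.push (h : IsAlmostTwoIntegrable k P D) (hk : 1 ≤ k) :
    IsAlmostTwoIntegrable k (pushModel T P) (pushDiffeology T D) where
  isModel := h.isModel.push T
  memLp η v hv := by
    obtain ⟨p, hp, x, w, rfl, rfl⟩ := exists_plotDifferential_eq (h.isModel.push T) hk hv
    apply HasSqDensity.memLp_logRep
    obtain ⟨V, hVU, hx, ⟨y, hy⟩ | ⟨q, hq, hpq⟩⟩ := hp x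
    · have h0 : plotDifferential p x w = 0 := plotDifferential_of_const hVU hy ⟨x, hx⟩ w
      rw [h0]
      exact hasSqDensity_zero _
    · have h1 : plotDifferential p x w = _ :=
        plotDifferential_of_lift T h.isModel hk hVU hq hpq ⟨x, hx⟩ w
      have h2 : p x = _ := hpq ⟨x, hx⟩
      rw [h1, h2]
      exact (h.hasSqDensity hk hq _ w).bindCLM T

theorem IsTwoIntegrable.push (h : IsTwoIntegrable k P D) (hk : 1 ≤ k) :
    IsTwoIntegrable k (pushModel T P) (pushDiffeology T D) where
  almost := h.almost.push T hk
  continuous_norm n U p hp := by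
    rw [continuous_iff_continuousAt]
    rintro ⟨x, w⟩
    obtain ⟨V, hVU, hx, hV⟩ := hp x
    -- Continuity at a point may be tested on the open part `V × ℝⁿ` of the tangent bundle, where
    -- `p` is constant or lifts.
    have hj : IsOpenEmbedding (Prod.map (Set.inclusion hVU) id : V × RSpace n → U × RSpace n) :=
      (Opens.isOpenEmbedding_of_le hVU).prodMap .id
    refine (hj.continuousAt_iff (x := (⟨x, hx⟩, w))).1 ?_
    rcases hV with ⟨y, hy⟩ | ⟨q, hq, hpq⟩
    · refine (continuousAt_const (y := (0 : ℝ))).congr (Eventually.of_forall fun z => ?_)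
      simp [plotDifferential_of_const hVU hy]
    · have hm := h.almost.isModel
      have key (z : V × RSpace n) : fisherNorm (p (Set.inclusion hVU z.1)).1
          (plotDifferential p (Set.inclusion hVU z.1) z.2) =
          fisherNorm (markovMap T (q z.1).1) (bindCLM T (plotDifferential q z.1 z.2)) := by
        rw [plotDifferential_of_lift T hm hk hVU hq hpq, hpq]
        rfl
      refine ContinuousAt.congr ?_ (Eventually.of_forall fun z => (key z).symm)
      -- Convergence of the Fisher norms upstairs is the 2-integrability of the original model along
      -- the lift `q`.
      exact tendsto_fisherNorm_bindCLM T
        (((hm.continuous_incl hq).comp continuous_fst).tendsto _)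
        ((hm.continuous_plotDifferential hk hq).tendsto _)
        (fun z => h.almost.hasSqDensity hk hq z.1 z.2) (h.almost.hasSqDensity hk hq _ _)
        ((h.continuous_norm n V q hq).tendsto _)

end Tangent

end DiffStat

end

theorem mainTheorem1 {𝒳 𝒴 : Type*} [MeasurableSpace 𝒳] [MeasurableSpace 𝒴]
    (T : Kernel 𝒳 𝒴) [IsMarkovKernel T] (k : ℕ∞) (hk : 1 ≤ k)
    (P : Set (ProbabilityMeasure 𝒳)) (D : DiffStat.ParamSet P)
    (hPD : DiffStat.IsDiffeologicalModel k P D) :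
    DiffStat.IsDiffeologicalModel k (DiffStat.pushModel T P) (DiffStat.pushDiffeology T D) ∧
    (DiffStat.IsAlmostTwoIntegrable k P D →
      DiffStat.IsAlmostTwoIntegrable k (DiffStat.pushModel T P) (DiffStat.pushDiffeology T D)) ∧
    (DiffStat.IsTwoIntegrable k P D →
      DiffStat.IsTwoIntegrable k (DiffStat.pushModel T P) (DiffStat.pushDiffeology T D)) :=
  ⟨hPD.push T, fun h => h.push T hk, fun h => h.push T hk⟩
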